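/- Consider one-sided matching markets with $n\ge 1$ agents and finitely many (any number $m$ of) items, where each agent $a$ has a strict preference list $L_a$ on an arbitrary subset of the items (he prefers to stay unmatched over receiving an item that is not on $L_a$). Getting the $j$-th item of $L_a$ gives agent $a$ utility $(|L_a|+1-j)/|L_a|$, and an unmatched agent has utility $0$. A matching gives each agent at most one item, which must be on his list, and gives each item to at most one agent; let $\mathrm{OPT}$ be the maximum total utility of a matching. In random serial dictatorship (RSD) the agents arrive in a uniformly random order, and each arriving agent takes the first item of his list that has not been taken, or stays unmatched if there is none; let $\mathrm{RSD}$ be the expected total utility of the resulting matching. (1) There are constants $c>0$ and $k\in\mathbb N$ such that for every such market $$\mathrm{RSD}\ \ge\ \frac{c}{n^{1/3}\,(\log (n+1))^{k}}\ \mathrm{OPT}.$$ (2) There are constants $C>0$ and $k\in\mathbb N$ such that for every $n\ge 1$, with $s=\lfloor n^{1/3}\rfloor$, the following market with $n$ agents has $\mathrm{OPT}>0$ and $$\mathrm{RSD}\ \le\ \frac{C\,(\log (n+1))^{k}}{n^{1/3}}\ \mathrm{OPT}.$$ The items are $1,\dots,s^2$ and $1',\dots,s'$. There are $s^2$ good agents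 $g_1,\dots,g_{s^2}$ and $n-s^2$ bad agents $b_1,\dots,b_{n-s^2}$. The list of $g_i$ is the single item $i$; the list of $b_j$ is $1',2',\dots,s'$ followed by the item $1+(j \bmod s^2)$. -/

import Mathlib

/-- A one-sided matching market with (possibly) incomplete preference lists: every agent `a : A`
strictly ranks, from best to worst, an arbitrary set of items; he prefers to stay unmatched over
receiving an item that is not on his list. -/
structure Market (A I : Type*) where
  /-- the preference list of each agent, best item first -/
  pref : A → List I
  nodup : ∀ a, (pref a).Nodup

namespace Market

variable {A I : Type*}

/-- Linear utility, normalized by the list length `ℓ`: the item at the `0`-based position `p` of the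
list is worth `(ℓ - p) / ℓ`, so the first item is worth `1` and the last one `1 / ℓ`. An item that is
not on the list is worth nothing. -/
noncomputable def utility [DecidableEq I] (P : Market A I) (a : A) (i : I) : ℝ :=
  if i ∈ P.pref a then
    (((P.pref a).length : ℝ) - ((P.pref a).idxOf i : ℝ)) / ((P.pref a).length : ℝ)
  else 0

/-- The social welfare of an allocation `μ`, where `μ a = none` means that `a` is unmatched. -/
noncomputable def welfare [Fintype A] [DecidableEq I] (P : Market A I) (μ : A → Option I) : ℝ :=
  ∑ a, (μ a).elim 0 (P.utility a)

/-- `μ` is a matching: each matched agent gets an item of his list, and no item is given twice. -/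
def IsMatching (P : Market A I) (μ : A → Option I) : Prop :=
  (∀ a i, μ a = some i → i ∈ P.pref a) ∧
    ∀ a b i, μ a = some i → μ b = some i → a = b

/-- The social optimum: the largest welfare of a matching. -/
noncomputable def opt [Fintype A] [DecidableEq I] (P : Market A I) : ℝ :=
  ⨆ μ : {μ : A → Option I // P.IsMatching μ}, P.welfare μ.1

/-- One step of serial dictatorship: agent `a` arrives when `μ` is the current allocation, and takes
the first item of his list that nobody holds (he stays unmatched if there is none). -/
def pick [Fintype A] [DecidableEq A] [DecidableEq I] (P : Market A I)
    (μ : A → Option I) (a : A) : A → Option I :=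
  Function.update μ a ((P.pref a).find? fun i => decide (∀ b, μ b ≠ some i))

/-- Serial dictatorship: the agents arrive one by one in the order `σ 0, σ 1, …`. -/
def serialDictatorship [Fintype A] [DecidableEq A] [DecidableEq I] (P : Market A I)
    (σ : Fin (Fintype.card A) ≃ A) : A → Option I :=
  (List.ofFn σ).foldl P.pick fun _ => none

/-- The expected welfare of random serial dictatorship: the arrival order is uniformly random. -/
noncomputable def rsdWelfare [Fintype A] [DecidableEq A] [DecidableEq I] (P : Market A I) : ℝ :=
  (∑ σ : Fin (Fintype.card A) ≃ A, P.welfare (P.serialDictatorship σ)) /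
    (Fintype.card (Fin (Fintype.card A) ≃ A) : ℝ)

/-- The market of good and bad agents. There are `s ^ 2` good agents and `n - s ^ 2` bad agents; the
items consist of `s ^ 2` items `Sum.inl i` and `s` items `Sum.inr i`. The list of the good agent `g`
is the single item `Sum.inl g`. A bad agent lists all the items `Sum.inr 0, Sum.inr 1, …` in this
order, followed by one item of the other kind; these last items are assigned cyclically. The bad
agents `b_1, b_2, …` are here `Sum.inr 0, Sum.inr 1, …`. -/
def goodBad (n s : ℕ) (hs : 0 < s) :
    Market (Fin (s ^ 2) ⊕ Fin (n - s ^ 2)) (Fin (s ^ 2) ⊕ Fin s) where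
  pref
    | Sum.inl g => [Sum.inl g]
    | Sum.inr b => (List.finRange s).map Sum.inr ++
        [Sum.inl ⟨((b : ℕ) + 1) % s ^ 2, Nat.mod_lt _ (pow_pos hs 2)⟩]
  nodup := by
    rintro (g | b)
    · simp
    · refine List.Nodup.append ((List.nodup_finRange s).map Sum.inr_injective)
        (List.nodup_singleton _) ?_
      simp [List.disjoint_singleton]

end Market

/-! Lower bound. Let a matching have welfare `k`, let `W` be the expected welfare of RSD, and put `T
≈ 2nW/k`. If `T > n/4`, then `k ≤ 8W`. Otherwise, unless the first `T` arrivals take about `k` items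
in expectation, the matching keeps a constant fraction of its value among late agents and free
items. Each of the times `0, …, T` would then yield about `k/n`, and RSD would earn more than `W`
(`mul_sub_le_rsdWelfare`). So at least `k/4` early agents are matched in expectation, and one of
`O(log n)` dyadic classes of list length contains a `1/O(log n)` share of them. Let that class have
`N` agents and lists of length about `L` (at least `L` in the capped top class). Up to logarithms,
`k ≲ LW`, since a matched agent earns about `1/L` or more (`avg_matched_class_le`); `k ≲ NT/n`,
hence `k² ≲ NW`, by counting arrivals (`avg_matched_class_le_card`); and `NL ≲ nW`, since an agent
among the first `L/2` arrivals earns at least `1/2` (`card_mul_le_rsdWelfare`). Multiplying gives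
`k³ ≲ nW³`, which is `welfare_pow_three_le`. Upper bound. The good agents alone make the optimum at
least `s²`, while RSD earns at most `4s` (`rsdWelfare_goodBad_le`): the primed items run out after
`s` bad agents, and each remaining good agent must arrive before about `s` competitors. -/

namespace Market

/-! ### Arrival times as list positions -/

section Order

variable {A : Type*} [Fintype A]

theorem mem_take_ofFn (σ : Fin (Fintype.card A) ≃ A) (t : ℕ) (a : A) :
    a ∈ (List.ofFn σ).take t ↔ (σ.symm a : ℕ) < t := by
  rw [List.mem_take_iff_getElem]
  constructor
  · rintro ⟨j, hj, rfl⟩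
    simp only [List.getElem_ofFn, Equiv.symm_apply_apply]
    exact lt_of_lt_of_le hj (min_le_left _ _)
  · intro h
    refine ⟨σ.symm a, ?_, ?_⟩
    · simp [h]
    · simp

theorem mem_drop_ofFn (σ : Fin (Fintype.card A) ≃ A) (t : ℕ) (a : A) :
    a ∈ (List.ofFn σ).drop t ↔ t ≤ (σ.symm a : ℕ) := by
  rw [List.mem_drop_iff_getElem]
  constructor
  · rintro ⟨j, hj, rfl⟩
    simp
  · intro h
    have := (σ.symm a).isLt
    refine ⟨σ.symm a - t, ?_, ?_⟩
    · simp; omega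
    · simp [Nat.add_sub_cancel' h]

end Order

/-! ### Serial dictatorship described through free items -/

section Dictatorship

variable {A I : Type*} [Fintype A] [DecidableEq A] [DecidableEq I]

/-- The allocation after the agents of the list `l` have arrived. -/
def run (P : Market A I) (l : List A) : A → Option I :=
  l.foldl P.pick fun _ => none

theorem run_concat (P : Market A I) (l : List A) (a : A) :
    P.run (l ++ [a]) = P.pick (P.run l) a := by
  simp [run]

theorem foldl_pick_of_notMem (P : Market A I) (l : List A) (μ : A → Option I) {a : A}
    (ha : a ∉ l) : l.foldl P.pick μ a = μ a := by
  induction l generalizing μ with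
  | nil => rfl
  | cons b l ih =>
    rw [List.mem_cons, not_or] at ha
    rw [List.foldl_cons, ih _ ha.2, pick, Function.update_of_ne ha.1]

theorem run_append_of_notMem (P : Market A I) (l l' : List A) {a : A} (ha : a ∉ l') :
    P.run (l ++ l') a = P.run l a := by
  rw [run, List.foldl_append, foldl_pick_of_notMem _ _ _ ha, run]

/-- The allocation after the first `t` arrivals is the restriction of the final one. -/
theorem run_take_ofFn (P : Market A I) (σ : Fin (Fintype.card A) ≃ A) (t : ℕ) (a : A) :
    P.run ((List.ofFn σ).take t) a =
      if (σ.symm a : ℕ) < t then P.serialDictatorship σ a else none := by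
  split_ifs with h
  · have : P.serialDictatorship σ a =
        P.run ((List.ofFn σ).take t ++ (List.ofFn σ).drop t) a := by
      rw [List.take_append_drop]; rfl
    rw [this, run_append_of_notMem]
    rw [mem_drop_ofFn]; omega
  · rw [run, foldl_pick_of_notMem]
    rwa [mem_take_ofFn]

/-- The item `i` is not taken by the agents arriving before time `t`. -/
def FreeAt (P : Market A I) (σ : Fin (Fintype.card A) ≃ A) (t : ℕ) (i : I) : Prop :=
  ∀ b, (σ.symm b : ℕ) < t → P.serialDictatorship σ b ≠ some i

theorem run_take_ofFn_ne_some (P : Market A I) (σ : Fin (Fintype.card A) ≃ A) (t : ℕ) (i : I) :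
    (∀ b, P.run ((List.ofFn σ).take t) b ≠ some i) ↔ P.FreeAt σ t i := by
  refine forall_congr' fun b => ?_
  rw [run_take_ofFn]
  split_ifs with h <;> simp [h]

open Classical in
-- The allocation seen on arrival is the final one restricted to earlier agents. This replaces the
-- fold by a fixed-point description, on which the later arguments rest.
theorem serialDictatorship_eq_find (P : Market A I) (σ : Fin (Fintype.card A) ≃ A) (a : A) :
    P.serialDictatorship σ a =
      (P.pref a).find? fun i => decide (P.FreeAt σ (σ.symm a) i) := by
  have h1 : P.serialDictatorship σ a = P.run ((List.ofFn σ).take (σ.symm a + 1)) a := by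
    rw [run_take_ofFn, if_pos (Nat.lt_succ_self _)]
  have h2 : (List.ofFn σ).take (σ.symm a + 1) = (List.ofFn σ).take (σ.symm a) ++ [a] := by
    rw [List.take_succ_eq_append_getElem (by simp)]
    simp
  rw [h1, h2, run_concat, pick, Function.update_self]
  simp_rw [run_take_ofFn_ne_some]

theorem FreeAt.mono {P : Market A I} {σ : Fin (Fintype.card A) ≃ A} {s t : ℕ} {i : I}
    (h : P.FreeAt σ t i) (hst : s ≤ t) : P.FreeAt σ s i :=
  fun b hb => h b (hb.trans_le hst)

theorem mem_pref_of_eq_some {P : Market A I} {σ : Fin (Fintype.card A) ≃ A} {a : A} {i : I}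
    (h : P.serialDictatorship σ a = some i) : i ∈ P.pref a := by
  classical
  rw [serialDictatorship_eq_find] at h
  exact List.mem_of_find?_eq_some h

theorem freeAt_of_eq_some {P : Market A I} {σ : Fin (Fintype.card A) ≃ A} {a : A} {i : I}
    (h : P.serialDictatorship σ a = some i) : P.FreeAt σ (σ.symm a) i := by
  classical
  rw [serialDictatorship_eq_find] at h
  simpa using List.find?_some h

theorem serialDictatorship_injective {P : Market A I} {σ : Fin (Fintype.card A) ≃ A} {a b : A}
    {i : I} (ha : P.serialDictatorship σ a = some i) (hb : P.serialDictatorship σ b = some i) :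
    a = b := by
  rcases lt_trichotomy (σ.symm a : ℕ) (σ.symm b : ℕ) with h | h | h
  · exact absurd ha (freeAt_of_eq_some hb a h)
  · exact σ.symm.injective (Fin.ext h)
  · exact absurd hb (freeAt_of_eq_some ha b h)

/-- Whether an item is free at time `t` does not depend on the order of the later arrivals. -/
theorem freeAt_congr (P : Market A I) {σ τ : Fin (Fintype.card A) ≃ A} {t : ℕ}
    (h : ∀ j : Fin (Fintype.card A), (j : ℕ) < t → σ j = τ j) (i : I) :
    P.FreeAt σ t i ↔ P.FreeAt τ t i := by
  have : (List.ofFn σ).take t = (List.ofFn τ).take t := by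
    refine List.ext_getElem (by simp) fun j h1 h2 => ?_
    simp only [List.length_take, List.length_ofFn, lt_min_iff] at h1
    simpa using h ⟨j, h1.2⟩ h1.1
  rw [← run_take_ofFn_ne_some, ← run_take_ofFn_ne_some, this]

/-- The utility that agent `a` derives from serial dictatorship. -/
noncomputable def payoff (P : Market A I) (σ : Fin (Fintype.card A) ≃ A) (a : A) : ℝ :=
  (P.serialDictatorship σ a).elim 0 (P.utility a)

end Dictatorship

/-! ### Bounds on the utility of a listed item -/

section Utility

variable {A I : Type*} [DecidableEq I]

theorem utility_nonneg (P : Market A I) (a : A) (i : I) : 0 ≤ P.utility a i := by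
  unfold utility
  split_ifs
  · have : ((P.pref a).idxOf i : ℝ) ≤ (P.pref a).length := by exact_mod_cast List.idxOf_le_length
    exact div_nonneg (by linarith) (by positivity)
  · exact le_rfl

theorem utility_le_one (P : Market A I) (a : A) (i : I) : P.utility a i ≤ 1 := by
  unfold utility
  split_ifs with h
  · refine div_le_one_of_le₀ ?_ (by positivity)
    have : (0 : ℝ) ≤ ((P.pref a).idxOf i : ℝ) := by positivity
    linarith
  · exact zero_le_one

theorem utility_eq (P : Market A I) {a : A} {i : I} (h : i ∈ P.pref a) :
    P.utility a i = 1 - ((P.pref a).idxOf i : ℝ) / (P.pref a).length := by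
  have : ((P.pref a).length : ℝ) ≠ 0 := by
    have := List.length_pos_of_mem h
    positivity
  rw [utility, if_pos h, sub_div, div_self this]

theorem one_div_length_le_utility (P : Market A I) {a : A} {i : I} (h : i ∈ P.pref a) :
    1 / ((P.pref a).length : ℝ) ≤ P.utility a i := by
  rw [utility, if_pos h]
  have : ((P.pref a).idxOf i : ℝ) + 1 ≤ (P.pref a).length := by
    exact_mod_cast List.idxOf_lt_length_of_mem h
  gcongr
  linarith

end Utility

/-! ### Pointwise lower bounds on payoffs -/

section Payoff

variable {A I : Type*} [Fintype A] [DecidableEq A] [DecidableEq I]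

theorem payoff_nonneg (P : Market A I) (σ : Fin (Fintype.card A) ≃ A) (a : A) :
    0 ≤ P.payoff σ a := by
  unfold payoff
  cases P.serialDictatorship σ a
  · exact le_rfl
  · exact P.utility_nonneg a _

/-- Items that an agent prefers to the one he picks are taken. -/
theorem not_freeAt_of_getElem (P : Market A I) (σ : Fin (Fintype.card A) ≃ A) (a : A) (j : ℕ)
    (hj : j < (P.pref a).length)
    (h : ∀ i, P.serialDictatorship σ a = some i → j < (P.pref a).idxOf i) :
    ¬ P.FreeAt σ (σ.symm a) (P.pref a)[j] := by
  classical
  intro hfree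
  rw [serialDictatorship_eq_find] at h
  cases hf : (P.pref a).find? fun i => decide (P.FreeAt σ (σ.symm a) i) with
  | none =>
    rw [List.find?_eq_none] at hf
    exact hf _ (List.getElem_mem hj) (by simpa using hfree)
  | some i =>
    have hlt := h i hf
    obtain ⟨-, m, hm, him, hall⟩ := List.find?_eq_some_iff_getElem.1 hf
    have : (P.pref a).idxOf i = m := by
      rw [← him]; exact (P.nodup a).idxOf_getElem m hm
    rw [this] at hlt
    have := hall j hlt
    simp [hfree] at this

theorem utility_le_payoff (P : Market A I) (σ : Fin (Fintype.card A) ≃ A) (a : A) (i : I)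
    (h : P.FreeAt σ (σ.symm a) i) : P.utility a i ≤ P.payoff σ a := by
  by_cases hi : i ∈ P.pref a
  swap
  · rw [utility, if_neg hi]; exact P.payoff_nonneg σ a
  have hlt := List.idxOf_lt_length_of_mem hi
  have key : ∃ i', P.serialDictatorship σ a = some i' ∧
      (P.pref a).idxOf i' ≤ (P.pref a).idxOf i := by
    by_contra! hcon
    refine P.not_freeAt_of_getElem σ a _ hlt hcon ?_
    rwa [List.getElem_idxOf]
  obtain ⟨i', h1, h2⟩ := key
  rw [payoff, h1, Option.elim_some, utility_eq P hi, utility_eq P (mem_pref_of_eq_some h1)]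
  gcongr

/-- If the first `j` items of `a` are taken on his arrival, then `j` agents have arrived before. -/
theorem le_symm_of_not_freeAt (P : Market A I) (σ : Fin (Fintype.card A) ≃ A) (a : A) (j : ℕ)
    (hj : j ≤ (P.pref a).length)
    (h : ∀ m (hm : m < (P.pref a).length), m < j → ¬ P.FreeAt σ (σ.symm a) (P.pref a)[m]) :
    j ≤ (σ.symm a : ℕ) := by
  have h' : ∀ m : Fin j, ∃ b, (σ.symm b : ℕ) < σ.symm a ∧
      P.serialDictatorship σ b = some ((P.pref a)[(m : ℕ)]'(m.2.trans_le hj)) := by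
    intro m
    have := h m (m.2.trans_le hj) m.2
    simpa [FreeAt] using this
  choose f hf1 hf2 using h'
  let g : Fin j → Fin (σ.symm a : ℕ) := fun m => ⟨σ.symm (f m), hf1 m⟩
  have hg : Function.Injective g := by
    intro m m' hmm
    have h1 : f m = f m' := σ.symm.injective (Fin.ext (by simpa [g] using hmm))
    have h2 := hf2 m
    rw [h1, hf2 m', Option.some_inj, (P.nodup a).getElem_inj_iff] at h2
    exact Fin.ext h2.symm
  simpa using Fintype.card_le_of_injective g hg

/-- Every item skipped was taken by a different earlier agent, so the 0-based position of the pick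
is at most the arrival time. If nothing is picked, the whole list was taken and the left side is
nonpositive. -/
theorem one_sub_div_le_payoff (P : Market A I) (σ : Fin (Fintype.card A) ≃ A) (a : A)
    (hne : P.pref a ≠ []) :
    1 - ((σ.symm a : ℕ) : ℝ) / (P.pref a).length ≤ P.payoff σ a := by
  have hpos : 0 < (P.pref a).length := List.length_pos_iff.2 hne
  cases hs : P.serialDictatorship σ a with
  | none =>
    have := P.le_symm_of_not_freeAt σ a _ le_rfl fun m hm _ =>
      P.not_freeAt_of_getElem σ a m hm (by simp [hs])
    rw [payoff, hs, Option.elim_none, sub_nonpos, one_le_div (by positivity)]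
    exact_mod_cast this
  | some i =>
    have hi := mem_pref_of_eq_some hs
    have := P.le_symm_of_not_freeAt σ a ((P.pref a).idxOf i) List.idxOf_le_length fun m hm hmi =>
      P.not_freeAt_of_getElem σ a m hm (by simpa [hs] using hmi)
    rw [payoff, hs, Option.elim_some, utility_eq P hi]
    gcongr

theorem one_div_length_le_payoff (P : Market A I) (σ : Fin (Fintype.card A) ≃ A) (a : A)
    (h : P.serialDictatorship σ a ≠ none) : 1 / ((P.pref a).length : ℝ) ≤ P.payoff σ a := by
  obtain ⟨i, hi⟩ := Option.ne_none_iff_exists'.1 h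
  rw [payoff, hi]
  exact P.one_div_length_le_utility (mem_pref_of_eq_some hi)

end Payoff

end Market

namespace Market

/-! ### Averages over arrival orders, and exchangeability of arrival times -/

section Average

variable {A : Type*} [Fintype A] [DecidableEq A]

/-- The average of `f` over all arrival orders. -/
noncomputable def avg (f : (Fin (Fintype.card A) ≃ A) → ℝ) : ℝ :=
  (∑ σ, f σ) / (Fintype.card (Fin (Fintype.card A) ≃ A) : ℝ)

theorem card_order_pos : (0 : ℝ) < (Fintype.card (Fin (Fintype.card A) ≃ A) : ℝ) := by
  have : Nonempty (Fin (Fintype.card A) ≃ A) := ⟨(Fintype.equivFin A).symm⟩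
  exact_mod_cast Fintype.card_pos

theorem avg_mono {f g : (Fin (Fintype.card A) ≃ A) → ℝ} (h : ∀ σ, f σ ≤ g σ) : avg f ≤ avg g := by
  unfold avg
  gcongr
  exact h _

theorem avg_const (c : ℝ) : avg (fun _ : Fin (Fintype.card A) ≃ A => c) = c := by
  have := (card_order_pos (A := A)).ne'
  simp only [avg, Finset.sum_const, Finset.card_univ, nsmul_eq_mul]
  field_simp

theorem avg_nonneg {f : (Fin (Fintype.card A) ≃ A) → ℝ} (h : ∀ σ, 0 ≤ f σ) : 0 ≤ avg f :=
  div_nonneg (Finset.sum_nonneg fun σ _ => h σ) card_order_pos.le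

theorem avg_sum {ι : Type*} (s : Finset ι) (f : ι → (Fin (Fintype.card A) ≃ A) → ℝ) :
    avg (fun σ => ∑ i ∈ s, f i σ) = ∑ i ∈ s, avg (f i) := by
  simp only [avg]
  rw [Finset.sum_comm, Finset.sum_div]

theorem avg_const_mul (c : ℝ) (f : (Fin (Fintype.card A) ≃ A) → ℝ) :
    avg (fun σ => c * f σ) = c * avg f := by
  simp only [avg, ← Finset.mul_sum, mul_div_assoc]

theorem avg_add (f g : (Fin (Fintype.card A) ≃ A) → ℝ) :
    avg (fun σ => f σ + g σ) = avg f + avg g := by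
  simp only [avg, Finset.sum_add_distrib, add_div]

theorem avg_sub (f g : (Fin (Fintype.card A) ≃ A) → ℝ) :
    avg (fun σ => f σ - g σ) = avg f - avg g := by
  simp only [avg, Finset.sum_sub_distrib, sub_div]

theorem avg_comp_equiv (e : (Fin (Fintype.card A) ≃ A) ≃ (Fin (Fintype.card A) ≃ A))
    (f : (Fin (Fintype.card A) ≃ A) → ℝ) : avg (fun σ => f (e σ)) = avg f := by
  simp only [avg]
  rw [Equiv.sum_comp e f]

open Classical in
/-- Given what happens before time `t`, a given agent is as likely to arrive at time `t` as at any
later time. -/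
theorem avg_arrival_eq (s t : Fin (Fintype.card A)) (a : A)
    (q : (Fin (Fintype.card A) ≃ A) → Prop)
    (hq : ∀ σ, q ((Equiv.swap s t).trans σ) ↔ q σ) :
    avg (fun σ => if σ.symm a = s ∧ q σ then (1 : ℝ) else 0) =
      avg (fun σ => if σ.symm a = t ∧ q σ then (1 : ℝ) else 0) := by
  -- Exchanging the times `s` and `t` permutes the set of orders.
  rw [← avg_comp_equiv (Equiv.equivCongr (Equiv.swap s t) (Equiv.refl A))]
  congr 1
  funext σ
  have h1 : Equiv.equivCongr (Equiv.swap s t) (Equiv.refl A) σ = (Equiv.swap s t).trans σ := by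
    ext; simp [Equiv.equivCongr]
  rw [h1]
  refine if_congr (and_congr ?_ (hq σ)) rfl rfl
  rw [Equiv.symm_trans_apply, Equiv.symm_swap, Equiv.swap_apply_eq_iff, Equiv.swap_apply_left]

open Classical in
theorem avg_arrival_lt (a : A) {m : ℕ} (hm : m ≤ Fintype.card A) :
    avg (fun σ => if (σ.symm a : ℕ) < m then (1 : ℝ) else 0) = m / Fintype.card A := by
  have hn : 0 < Fintype.card A := Fintype.card_pos_iff.2 ⟨a⟩
  let p : Fin (Fintype.card A) → ℝ := fun s =>
    avg (fun σ : Fin (Fintype.card A) ≃ A => if σ.symm a = s then (1 : ℝ) else 0)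
  have hp : ∀ s t, p s = p t := fun s t => by
    simpa using avg_arrival_eq s t a (fun _ => True) (by simp)
  have hsum : ∑ s, p s = 1 := by
    rw [← avg_sum]
    simp [avg_const]
  have hp1 : ∀ s, p s = 1 / Fintype.card A := fun s => by
    rw [Finset.sum_congr rfl fun t _ => hp t s, Finset.sum_const, Finset.card_univ, Fintype.card_fin,
      nsmul_eq_mul] at hsum
    field_simp
    linarith
  have : (fun σ : Fin (Fintype.card A) ≃ A => if (σ.symm a : ℕ) < m then (1 : ℝ) else 0) =
      fun σ => ∑ s ∈ Finset.univ.filter (fun s : Fin (Fintype.card A) => (s : ℕ) < m),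
        if σ.symm a = s then (1 : ℝ) else 0 := by
    funext σ
    simp [Finset.sum_ite_eq]
  rw [this, avg_sum, Finset.sum_congr rfl fun s _ => hp1 s, Finset.sum_const, nsmul_eq_mul,
    Fin.card_filter_val_lt, min_eq_right hm]
  ring

open Classical in
/-- Comparison of the arrival at time `t` with the arrival at some time from `t` on. -/
theorem avg_arrival_ge (t : Fin (Fintype.card A)) (a : A) (q : (Fin (Fintype.card A) ≃ A) → Prop)
    (hq : ∀ s ≥ t, ∀ σ, q ((Equiv.swap s t).trans σ) ↔ q σ) :
    1 / (Fintype.card A : ℝ) *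
        avg (fun σ => if (t : ℕ) ≤ σ.symm a ∧ q σ then (1 : ℝ) else 0) ≤
      avg (fun σ => if σ.symm a = t ∧ q σ then (1 : ℝ) else 0) := by
  have hn : 0 < Fintype.card A := Fintype.card_pos_iff.2 ⟨a⟩
  set x := avg (fun σ => if σ.symm a = t ∧ q σ then (1 : ℝ) else 0) with hx
  have hx0 : 0 ≤ x := avg_nonneg fun σ => by split_ifs <;> norm_num
  have : (fun σ : Fin (Fintype.card A) ≃ A =>
      if (t : ℕ) ≤ σ.symm a ∧ q σ then (1 : ℝ) else 0) =
      fun σ => ∑ s ∈ Finset.Ici t, if σ.symm a = s ∧ q σ then (1 : ℝ) else 0 := by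
    funext σ
    by_cases h : q σ
    · simp only [h, and_true, Finset.sum_ite_eq, Finset.mem_Ici]
      exact if_congr Iff.rfl rfl rfl
    · simp [h]
  have hs : ∀ s ∈ Finset.Ici t, avg (fun σ => if σ.symm a = s ∧ q σ then (1 : ℝ) else 0) = x :=
    fun s hs => avg_arrival_eq s t a q (hq s (Finset.mem_Ici.1 hs))
  rw [this, avg_sum, Finset.sum_congr rfl hs, Finset.sum_const, nsmul_eq_mul,
    Fin.card_Ici, one_div_mul_eq_div, div_le_iff₀ (by positivity), mul_comm x]
  exact mul_le_mul_of_nonneg_right (by exact_mod_cast Nat.sub_le _ _) hx0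

end Average

/-! ### Dyadic classes of list lengths -/

section LengthClass

variable {A I : Type*} [Fintype A]

/-- The dyadic class of the list length of an agent, capped above the number of agents. -/
def lengthClass (P : Market A I) (a : A) : ℕ :=
  min (Nat.log 2 (P.pref a).length) (Nat.log 2 (Fintype.card A) + 1)

theorem two_pow_lengthClass_le (P : Market A I) {a : A} (h : P.pref a ≠ []) :
    2 ^ P.lengthClass a ≤ (P.pref a).length :=
  (Nat.pow_le_pow_right two_pos (min_le_left _ _)).trans
    (Nat.pow_log_le_self 2 (List.length_pos_iff.2 h).ne')

end LengthClass

/-! ### The lower bound on the welfare of RSD -/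

section LowerBound

variable {A I : Type*} [Fintype A] [DecidableEq A] [DecidableEq I]

theorem rsdWelfare_eq_avg (P : Market A I) :
    P.rsdWelfare = avg (fun σ => ∑ a, P.payoff σ a) := rfl

theorem rsdWelfare_nonneg (P : Market A I) : 0 ≤ P.rsdWelfare := by
  rw [rsdWelfare_eq_avg]
  exact avg_nonneg fun σ => Finset.sum_nonneg fun a _ => P.payoff_nonneg σ a

open Classical in
/-- The set of agents arriving before time `t` that get an item. -/
noncomputable def matched (P : Market A I) (σ : Fin (Fintype.card A) ≃ A) (t : ℕ) : Finset A :=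
  Finset.univ.filter fun a => (σ.symm a : ℕ) < t ∧ P.serialDictatorship σ a ≠ none

theorem matched_mono (P : Market A I) (σ : Fin (Fintype.card A) ≃ A) {s t : ℕ} (h : s ≤ t) :
    P.matched σ s ⊆ P.matched σ t := by
  intro a
  simp only [matched, Finset.mem_filter, Finset.mem_univ, true_and]
  exact fun ha => ⟨ha.1.trans_le h, ha.2⟩

open Classical in
/-- In a matching, at most one unit of welfare is lost per item that is taken. -/
theorem sum_utility_taken_le (P : Market A I) {μ : A → Option I} (hμ : P.IsMatching μ)
    (σ : Fin (Fintype.card A) ≃ A) (t : ℕ) :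
    ∑ a, (μ a).elim 0 (fun i => if P.FreeAt σ t i then 0 else P.utility a i) ≤
      (P.matched σ t).card := by
  let S : Finset A := Finset.univ.filter fun a => ∃ i, μ a = some i ∧ ¬ P.FreeAt σ t i
  have h1 : ∀ a, (μ a).elim 0 (fun i => if P.FreeAt σ t i then 0 else P.utility a i) ≤
      if a ∈ S then 1 else 0 := by
    intro a
    cases h : μ a with
    | none => simp only [Option.elim_none]; split_ifs <;> norm_num
    | some i =>
      simp only [Option.elim_some, S, Finset.mem_filter, Finset.mem_univ, true_and, h,
        Option.some_inj, exists_eq_left']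
      by_cases hf : P.FreeAt σ t i
      · simp [hf]
      · simpa [hf] using P.utility_le_one a i
  have h2 : S.card ≤ (P.matched σ t).card := by
    have hS : ∀ a ∈ S, ∃ b, (σ.symm b : ℕ) < t ∧ P.serialDictatorship σ b = μ a ∧ μ a ≠ none := by
      intro a ha
      obtain ⟨i, hi, hf⟩ := (Finset.mem_filter.1 ha).2
      simp only [FreeAt, not_forall, not_not] at hf
      obtain ⟨b, hb, hbi⟩ := hf
      exact ⟨b, hb, hbi.trans hi.symm, by simp [hi]⟩
    choose! f hf using hS
    refine Finset.card_le_card_of_injOn f (fun a ha => ?_) fun a ha b hb hab => ?_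
    · have := hf a ha
      simp only [matched, Finset.coe_filter, Finset.mem_univ, true_and, Set.mem_ofPred_eq]
      exact ⟨this.1, by rw [this.2.1]; exact this.2.2⟩
    · have h1 := hf a ha
      have h2 := hf b hb
      obtain ⟨i, hi⟩ := Option.ne_none_iff_exists'.1 h1.2.2
      refine hμ.2 a b i hi ?_
      rw [← h2.2.1, ← hab, h1.2.1, hi]
  calc _ ≤ ∑ a, (if a ∈ S then (1 : ℝ) else 0) := Finset.sum_le_sum fun a _ => h1 a
    _ = S.card := by simp
    _ ≤ _ := by exact_mod_cast h2

open Classical in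
-- Whoever arrives at time `t` earns at least the value of his item in `μ` if it is still free.
-- Freeness at `t` depends only on earlier arrivals, so an agent not yet arrived comes at `t` with
-- conditional probability at least `1/n`. The losses are agents that came before `t` (a fraction
-- `t/n`) and taken items (at most one unit per matched agent).
theorem avg_payoff_at_ge (P : Market A I) {μ : A → Option I} (hμ : P.IsMatching μ)
    (t : Fin (Fintype.card A)) :
    1 / (Fintype.card A : ℝ) * (P.welfare μ * (1 - (t : ℕ) / (Fintype.card A : ℝ)) -
        avg (fun σ => ((P.matched σ t).card : ℝ))) ≤
      avg (fun σ => P.payoff σ (σ t)) := by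
  have hpoint : ∀ σ : Fin (Fintype.card A) ≃ A,
      ∑ a, (μ a).elim 0 (fun i => P.utility a i *
        if σ.symm a = t ∧ P.FreeAt σ t i then (1 : ℝ) else 0) ≤ P.payoff σ (σ t) := by
    intro σ
    rw [Finset.sum_eq_single (σ t)]
    · cases h : μ (σ t) with
      | none => exact P.payoff_nonneg _ _
      | some i =>
        simp only [Option.elim_some, Equiv.symm_apply_apply, true_and]
        split_ifs with hf
        · rw [mul_one]
          exact P.utility_le_payoff σ (σ t) i (by simpa using hf)
        · rw [mul_zero]; exact P.payoff_nonneg _ _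
    · intro b _ hb
      have : ¬ σ.symm b = t := fun h => hb (by simp [← h])
      cases μ b <;> simp [this]
    · simp
  refine le_trans ?_ (avg_mono hpoint)
  rw [avg_sum]
  have hagent : ∀ a, 1 / (Fintype.card A : ℝ) * ((μ a).elim 0 (P.utility a) * (1 - (t : ℕ) / (Fintype.card A : ℝ)) -
      avg (fun σ => (μ a).elim 0 (fun i => if P.FreeAt σ t i then 0 else P.utility a i))) ≤
      avg (fun σ => (μ a).elim 0 (fun i => P.utility a i *
        if σ.symm a = t ∧ P.FreeAt σ t i then (1 : ℝ) else 0)) := by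
    intro a
    cases h : μ a with
    | none => simp [avg_const]
    | some i =>
      simp only [Option.elim_some]
      rw [avg_const_mul]
      refine le_trans ?_ (mul_le_mul_of_nonneg_left
        (avg_arrival_ge t a (fun σ => P.FreeAt σ t i) ?_) (P.utility_nonneg a i))
      · have h1 : avg (fun σ => if P.FreeAt σ t i then 0 else P.utility a i) =
            P.utility a i * avg (fun σ => if P.FreeAt σ t i then (0 : ℝ) else 1) := by
          rw [← avg_const_mul]
          congr 1; funext σ; split_ifs <;> simp
        have h2 : 1 - ((t : ℕ) : ℝ) / (Fintype.card A : ℝ) - avg (fun σ => if P.FreeAt σ t i then (0 : ℝ) else 1) ≤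
            avg (fun σ => if (t : ℕ) ≤ σ.symm a ∧ P.FreeAt σ t i then (1 : ℝ) else 0) := by
          -- A union bound over the two ways to fail: `a` came early, or `i` is taken.
          have hle : ∀ σ : Fin (Fintype.card A) ≃ A,
              (1 : ℝ) - (if (σ.symm a : ℕ) < t then 1 else 0) - (if P.FreeAt σ t i then 0 else 1) ≤
                if (t : ℕ) ≤ σ.symm a ∧ P.FreeAt σ t i then (1 : ℝ) else 0 := by
            intro σ
            by_cases c1 : (σ.symm a : ℕ) < t
            · rw [if_pos c1]
              split_ifs <;> norm_num
            · rw [if_neg c1]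
              by_cases c2 : P.FreeAt σ t i
              · rw [if_pos c2, if_pos ⟨not_lt.1 c1, c2⟩]
                norm_num
              · rw [if_neg c2]
                split_ifs <;> norm_num
          have := avg_mono hle
          rwa [avg_sub, avg_sub, avg_const, avg_arrival_lt a t.2.le] at this
        have h3 := P.utility_nonneg a i
        rw [h1, mul_left_comm (P.utility a i) (1 / (Fintype.card A : ℝ)), ← mul_sub]
        gcongr
      · intro s hs σ
        refine P.freeAt_congr (fun j hj => ?_) i
        rw [Equiv.trans_apply, Equiv.swap_apply_of_ne_of_ne]
        · rintro rfl; exact absurd hj (by have := Fin.le_def.1 hs; omega)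
        · rintro rfl; exact absurd hj (lt_irrefl _)
  refine le_trans ?_ (Finset.sum_le_sum fun a _ => hagent a)
  rw [← Finset.mul_sum, Finset.sum_sub_distrib, ← Finset.sum_mul, ← avg_sum]
  have := avg_mono fun σ => P.sum_utility_taken_le hμ σ t
  unfold welfare
  gcongr

/-- The bound on the payoff at time `t` weakens as `t` grows, so its value at `T` serves for all `T
+ 1` times up to `T`. -/
theorem mul_sub_le_rsdWelfare (P : Market A I) {μ : A → Option I} (hμ : P.IsMatching μ) {T : ℕ}
    (hT : T + 1 ≤ Fintype.card A) :
    ((T : ℝ) + 1) / Fintype.card A * (P.welfare μ * (1 - (T : ℝ) / Fintype.card A) -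
      avg (fun σ => ((P.matched σ T).card : ℝ))) ≤ P.rsdWelfare := by
  have hμ0 : 0 ≤ P.welfare μ := by
    refine Finset.sum_nonneg fun a _ => ?_
    cases μ a
    · exact le_rfl
    · exact P.utility_nonneg a _
  let S : Finset (Fin (Fintype.card A)) := Finset.univ.filter fun t => (t : ℕ) < T + 1
  have hS : S.card = T + 1 := by
    rw [Fin.card_filter_val_lt, min_eq_right hT]
  calc _ = ∑ t ∈ S, 1 / (Fintype.card A : ℝ) * (P.welfare μ * (1 - (T : ℝ) / Fintype.card A) -
        avg (fun σ => ((P.matched σ T).card : ℝ))) := by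
        rw [Finset.sum_const, hS, nsmul_eq_mul]
        push_cast
        ring
    _ ≤ ∑ t ∈ S, avg (fun σ => P.payoff σ (σ t)) := by
        refine Finset.sum_le_sum fun t ht => le_trans ?_ (P.avg_payoff_at_ge hμ t)
        have htT : (t : ℕ) ≤ T := Nat.lt_succ_iff.1 (Finset.mem_filter.1 ht).2
        have : avg (fun σ => ((P.matched σ t).card : ℝ)) ≤
            avg (fun σ => ((P.matched σ T).card : ℝ)) :=
          avg_mono fun σ => by exact_mod_cast Finset.card_le_card (P.matched_mono σ htT)
        gcongr
    _ ≤ P.rsdWelfare := by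
        rw [← avg_sum, rsdWelfare_eq_avg]
        refine avg_mono fun σ => ?_
        rw [← Equiv.sum_comp σ (P.payoff σ)]
        exact Finset.sum_le_sum_of_subset_of_nonneg (Finset.subset_univ _) fun t _ _ =>
          P.payoff_nonneg _ _

theorem card_mul_le_rsdWelfare (P : Market A I) (S : Finset A) (L : ℕ)
    (hL : L ≤ 2 * Fintype.card A) (hS : ∀ a ∈ S, P.pref a ≠ [] ∧ L ≤ (P.pref a).length) :
    (S.card : ℝ) * L ≤ 4 * Fintype.card A * P.rsdWelfare := by
  classical
  rcases S.eq_empty_or_nonempty with rfl | ⟨a₀, -⟩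
  · have := P.rsdWelfare_nonneg
    simp only [Finset.card_empty, Nat.cast_zero, zero_mul]
    positivity
  have hn : (0 : ℝ) < Fintype.card A := by exact_mod_cast Fintype.card_pos_iff.2 ⟨a₀⟩
  -- Rounded up: an arrival time below `m` is still at most `L / 2`, so the payoff is at least
  -- `1/2`, while `L ≤ 2n` keeps `m ≤ n`.
  obtain ⟨m, hm⟩ : ∃ m, m = (L + 1) / 2 := ⟨_, rfl⟩
  have hLm : (L : ℝ) ≤ 2 * m := by
    have : L ≤ 2 * m := by omega
    exact_mod_cast this
  have key : ∑ a ∈ S, 1 / 2 * avg (fun σ => if (σ.symm a : ℕ) < m then (1 : ℝ) else 0) ≤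
      P.rsdWelfare := by
    simp_rw [← avg_const_mul]
    rw [← avg_sum, rsdWelfare_eq_avg]
    refine avg_mono fun σ => ?_
    refine le_trans (Finset.sum_le_sum fun a ha => ?_)
      (Finset.sum_le_sum_of_subset_of_nonneg (Finset.subset_univ S) fun a _ _ =>
        P.payoff_nonneg σ a)
    split_ifs with h
    · refine le_trans ?_ (P.one_sub_div_le_payoff σ a (hS a ha).1)
      have h1 := List.length_pos_iff.2 (hS a ha).1
      have h2 : 2 * (σ.symm a : ℕ) ≤ (P.pref a).length := by
        have := (hS a ha).2
        omega
      have h3 : 2 * ((σ.symm a : ℕ) : ℝ) ≤ (P.pref a).length := by exact_mod_cast h2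
      have : ((σ.symm a : ℕ) : ℝ) / (P.pref a).length ≤ 1 / 2 := by
        rw [div_le_div_iff₀ (by exact_mod_cast h1) two_pos]
        linarith
      linarith
    · rw [mul_zero]; exact P.payoff_nonneg σ a
  rw [Finset.sum_congr rfl fun a _ => by rw [avg_arrival_lt a (by omega : m ≤ Fintype.card A)],
    Finset.sum_const, nsmul_eq_mul] at key
  calc (S.card : ℝ) * L ≤ S.card * (2 * m) := by gcongr
    _ = 4 * Fintype.card A * (S.card * (1 / 2 * (m / Fintype.card A))) := by field_simp; ring
    _ ≤ _ := by gcongr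

/-- Below the cap, even the last item of a list shorter than `2 ^ (j + 1)` is worth this much. At
the cap the list may be far longer than `2 ^ j`, but `2 ^ j` exceeds `n`, so the bound through the
arrival time applies. -/
theorem one_div_two_pow_le_payoff (P : Market A I) (σ : Fin (Fintype.card A) ≃ A) {a : A}
    (h : P.serialDictatorship σ a ≠ none) :
    1 / (2 * 2 ^ P.lengthClass a : ℝ) ≤ P.payoff σ a := by
  obtain ⟨i, hi⟩ := Option.ne_none_iff_exists'.1 h
  have hne : P.pref a ≠ [] := List.ne_nil_of_mem (mem_pref_of_eq_some hi)
  have hpos := List.length_pos_iff.2 hne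
  rcases le_total (Nat.log 2 (P.pref a).length) (Nat.log 2 (Fintype.card A) + 1) with hc | hc
  · refine le_trans ?_ (P.one_div_length_le_payoff σ a h)
    rw [lengthClass, min_eq_left hc]
    have : (P.pref a).length < 2 ^ (Nat.log 2 (P.pref a).length + 1) :=
      Nat.lt_pow_succ_log_self one_lt_two _
    have : ((P.pref a).length : ℝ) ≤ 2 * 2 ^ Nat.log 2 (P.pref a).length := by
      rw [← pow_succ']; exact_mod_cast this.le
    gcongr
  · refine le_trans ?_ (P.one_sub_div_le_payoff σ a hne)
    have h1 := P.two_pow_lengthClass_le hne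
    have h2 : Fintype.card A < 2 ^ P.lengthClass a := by
      rw [lengthClass, min_eq_right hc]; exact Nat.lt_pow_succ_log_self one_lt_two _
    have h3 := (σ.symm a).2
    have h4 : ((σ.symm a : ℕ) : ℝ) + 1 ≤ 2 ^ P.lengthClass a := by exact_mod_cast h3.trans h2
    have h5 : (2 : ℝ) ^ P.lengthClass a ≤ (P.pref a).length := by exact_mod_cast h1
    have h6 : ((σ.symm a : ℕ) : ℝ) / (P.pref a).length ≤
        ((σ.symm a : ℕ) : ℝ) / 2 ^ P.lengthClass a := by gcongr
    have h7 : (0 : ℝ) < 2 ^ P.lengthClass a := by positivity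
    have h8 : ((σ.symm a : ℕ) : ℝ) / 2 ^ P.lengthClass a ≤ 1 - 1 / 2 ^ P.lengthClass a := by
      rw [le_sub_iff_add_le, ← add_div, div_le_one h7]; exact h4
    have h9 : 1 / (2 * 2 ^ P.lengthClass a : ℝ) ≤ 1 / 2 ^ P.lengthClass a := by
      gcongr; linarith
    linarith

open Classical in
theorem avg_matched_class_le (P : Market A I) (T j : ℕ) :
    avg (fun σ => (((P.matched σ T).filter fun a => P.lengthClass a = j).card : ℝ)) ≤
      2 * 2 ^ j * P.rsdWelfare := by
  rw [rsdWelfare_eq_avg, ← avg_const_mul]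
  refine avg_mono fun σ => ?_
  rw [Finset.mul_sum, Finset.cast_card]
  refine le_trans (Finset.sum_le_sum fun a ha => ?_)
    (Finset.sum_le_sum_of_subset_of_nonneg (Finset.subset_univ _) fun a _ _ =>
      mul_nonneg (by positivity) (P.payoff_nonneg σ a))
  obtain ⟨h1, rfl⟩ := Finset.mem_filter.1 ha
  have := P.one_div_two_pow_le_payoff σ (Finset.mem_filter.1 h1).2.2
  rwa [div_le_iff₀' (by positivity)] at this

open Classical in
theorem avg_matched_class_le_card (P : Market A I) {T : ℕ} (hT : T ≤ Fintype.card A) (j : ℕ) :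
    avg (fun σ => (((P.matched σ T).filter fun a => P.lengthClass a = j).card : ℝ)) ≤
      (Finset.univ.filter fun a => P.lengthClass a = j ∧ P.pref a ≠ []).card *
        ((T : ℝ) / Fintype.card A) := by
  rw [← nsmul_eq_mul, ← Finset.sum_const,
    Finset.sum_congr rfl fun a _ => (avg_arrival_lt a hT).symm, ← avg_sum]
  refine avg_mono fun σ => ?_
  rw [← Finset.sum_filter, ← Finset.cast_card]
  refine Nat.cast_le.2 (Finset.card_le_card fun a ha => ?_)
  obtain ⟨h1, h2⟩ := Finset.mem_filter.1 ha
  obtain ⟨h3, h4⟩ := (Finset.mem_filter.1 h1).2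
  obtain ⟨i, hi⟩ := Option.ne_none_iff_exists'.1 h4
  simp only [Finset.mem_filter, Finset.mem_univ, true_and]
  exact ⟨⟨h2, List.ne_nil_of_mem (mem_pref_of_eq_some hi)⟩, h3⟩

theorem welfare_pow_three_le (P : Market A I) {μ : A → Option I} (hμ : P.IsMatching μ) :
    P.welfare μ ^ 3 ≤
      (8 * ((Nat.log 2 (Fintype.card A) : ℝ) + 2)) ^ 3 * Fintype.card A * P.rsdWelfare ^ 3 := by
  classical
  obtain ⟨k, hk⟩ : ∃ k, k = P.welfare μ := ⟨_, rfl⟩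
  obtain ⟨W, hW⟩ : ∃ W, W = P.rsdWelfare := ⟨_, rfl⟩
  obtain ⟨J, hJ⟩ : ∃ J, J = Nat.log 2 (Fintype.card A) := ⟨_, rfl⟩
  obtain ⟨n, hn⟩ : ∃ n, n = Fintype.card A := ⟨_, rfl⟩
  have hW0 : 0 ≤ W := hW ▸ P.rsdWelfare_nonneg
  rw [← hk, ← hW, ← hJ, ← hn]
  rcases le_or_gt k 0 with hk0 | hk0
  · have : k ^ 3 ≤ 0 := by
      rw [pow_succ]; exact mul_nonpos_of_nonneg_of_nonpos (sq_nonneg k) hk0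
    exact this.trans (by positivity)
  have hn1 : 1 ≤ n := by
    rw [hn, Nat.one_le_iff_ne_zero, Ne, Fintype.card_eq_zero_iff]
    intro hA
    rw [hk, welfare, Finset.univ_eq_empty, Finset.sum_empty] at hk0
    exact hk0.false
  have hn0 : (0 : ℝ) < n := by exact_mod_cast hn1
  have hn1' : (1 : ℝ) ≤ n := by exact_mod_cast hn1
  have hD : (2 : ℝ) ≤ (J : ℝ) + 2 := by linarith [Nat.cast_nonneg (α := ℝ) J]
  obtain ⟨D, hDD⟩ : ∃ D : ℝ, D = (J : ℝ) + 2 := ⟨_, rfl⟩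
  rw [← hDD] at hD ⊢
  -- Chosen so that `T + 1` steps each earning `k / (2n)` would exceed `W`.
  obtain ⟨T, hT⟩ : ∃ T, T = ⌊2 * n * W / k⌋₊ := ⟨_, rfl⟩
  have hT1 : (T : ℝ) ≤ 2 * n * W / k := hT ▸ Nat.floor_le (by positivity)
  have hT2 : 2 * n * W / k < T + 1 := hT ▸ Nat.lt_floor_add_one _
  rw [le_div_iff₀ hk0] at hT1
  rw [div_lt_iff₀ hk0] at hT2
  rcases lt_or_ge (n : ℝ) (4 * T) with hcase | hcase
  · have h1 : k ≤ 8 * W := by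
      have : n * k ≤ n * (8 * W) := by nlinarith
      exact le_of_mul_le_mul_left this hn0
    calc k ^ 3 ≤ (8 * W) ^ 3 := by gcongr
      _ = 8 ^ 3 * 1 * W ^ 3 := by ring
      _ ≤ (8 * D) ^ 3 * n * W ^ 3 := by gcongr; linarith
  have hTn : T + 1 ≤ n := by
    have : 4 * T ≤ n := by exact_mod_cast hcase
    omega
  have hmain := P.mul_sub_le_rsdWelfare hμ (hn ▸ hTn)
  obtain ⟨M, hM⟩ : ∃ M, M = avg (fun σ => ((P.matched σ T).card : ℝ)) := ⟨_, rfl⟩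
  rw [← hM, ← hk, ← hW, ← hn] at hmain
  have hM4 : k / 4 ≤ M := by
    by_contra! hlt
    have h1 : (T : ℝ) / n ≤ 1 / 4 := by
      rw [div_le_div_iff₀ hn0 (by norm_num)]; linarith
    have h2 : k / 2 ≤ k * (1 - T / n) - M := by nlinarith
    have h3 : ((T : ℝ) + 1) / n * (k / 2) ≤ W :=
      le_trans (mul_le_mul_of_nonneg_left h2 (by positivity)) hmain
    rw [div_mul_eq_mul_div, div_le_iff₀ hn0] at h3
    linarith
  have hsum : M = ∑ j ∈ Finset.range (J + 2),
      avg (fun σ => (((P.matched σ T).filter fun a => P.lengthClass a = j).card : ℝ)) := by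
    rw [← avg_sum, hM]
    congr 1
    funext σ
    rw [← Nat.cast_sum, ← Finset.card_eq_sum_card_fiberwise]
    intro a _
    simp only [Finset.coe_range, Set.mem_Iio, lengthClass, hJ]
    omega
  -- Pigeonhole over the `D = J + 2` length classes.
  obtain ⟨j, hj, hjk⟩ : ∃ j ∈ Finset.range (J + 2), k / (4 * D) ≤
      avg (fun σ => (((P.matched σ T).filter fun a => P.lengthClass a = j).card : ℝ)) := by
    refine Finset.exists_le_of_sum_le (by simp) ?_
    rw [← hsum, Finset.sum_const, Finset.card_range, nsmul_eq_mul]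
    refine le_trans (le_of_eq ?_) hM4
    push_cast
    rw [← hDD]
    field_simp
  have e1 := hjk.trans (P.avg_matched_class_le T j)
  have e2 := hjk.trans (P.avg_matched_class_le_card (by omega) j)
  have e3 := P.card_mul_le_rsdWelfare
    (Finset.univ.filter fun a => P.lengthClass a = j ∧ P.pref a ≠ []) (2 ^ j) ?_ ?_
  · obtain ⟨N, hN⟩ : ∃ N : ℝ, N =
      (Finset.univ.filter fun a => P.lengthClass a = j ∧ P.pref a ≠ []).card := ⟨_, rfl⟩
    have hN0 : 0 ≤ N := hN ▸ Nat.cast_nonneg _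
    push_cast at e3
    rw [← hN, ← hW, ← hn] at e3
    rw [← hN, ← hn] at e2
    rw [← hW] at e1
    obtain ⟨L, hL⟩ : ∃ L : ℝ, L = 2 ^ j := ⟨_, rfl⟩
    rw [← hL] at e1 e3
    have f1 : k / (8 * D) ≤ L * W := by
      have : k / (8 * D) = k / (4 * D) / 2 := by field_simp; norm_num
      linarith
    have f2 : k ^ 2 / (8 * D) ≤ N * W := by
      have g1 : N * (T / n) * k ≤ N * (2 * W) := by
        rw [mul_assoc]
        refine mul_le_mul_of_nonneg_left ?_ hN0
        rw [div_mul_eq_mul_div, div_le_iff₀ hn0]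
        linarith
      have g2 := mul_le_mul_of_nonneg_right e2 hk0.le
      have : k ^ 2 / (8 * D) = k / (4 * D) * k / 2 := by field_simp; norm_num
      linarith
    -- The unknown class parameters occur only as `N * L`, which `e3` bounds.
    have f3 : k ^ 3 / (64 * D ^ 2) ≤ 4 * n * W ^ 3 := by
      calc k ^ 3 / (64 * D ^ 2) = k ^ 2 / (8 * D) * (k / (8 * D)) := by field_simp; norm_num
        _ ≤ N * W * (L * W) := by gcongr
        _ = N * L * W ^ 2 := by ring
        _ ≤ 4 * n * W * W ^ 2 := by gcongr
        _ = _ := by ring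
    rw [div_le_iff₀ (by positivity)] at f3
    refine f3.trans ?_
    have : 0 ≤ n * W ^ 3 * D ^ 2 := by positivity
    nlinarith
  -- The cap on the classes is what gives `2 ^ j ≤ 2n`.
  · have h1 : j ≤ J + 1 := by simpa [Nat.lt_succ_iff] using hj
    calc 2 ^ j ≤ 2 ^ (J + 1) := Nat.pow_le_pow_right two_pos h1
      _ = 2 * 2 ^ J := pow_succ' _ _
      _ ≤ _ := by
        gcongr
        rw [hJ]
        exact Nat.pow_log_le_self 2 (by omega)
  · intro a ha
    obtain ⟨rfl, h2⟩ := (Finset.mem_filter.1 ha).2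
    exact ⟨h2, P.two_pow_lengthClass_le h2⟩

theorem le_rsdWelfare (P : Market A I) (hn : 1 ≤ Fintype.card A) :
    Real.log 2 / 24 * (Fintype.card A : ℝ) ^ (-(1 / 3 : ℝ)) /
      Real.log ((Fintype.card A : ℝ) + 1) ^ 1 * P.opt ≤ P.rsdWelfare := by
  obtain ⟨n, hnn⟩ : ∃ n, n = Fintype.card A := ⟨_, rfl⟩
  rw [← hnn] at hn ⊢
  have hn1 : (1 : ℝ) ≤ n := by exact_mod_cast hn
  have hn0 : (0 : ℝ) < n := by linarith
  have hl2 : 0 < Real.log 2 := Real.log_pos one_lt_two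
  have hln : Real.log 2 ≤ Real.log (n + 1) := Real.log_le_log two_pos (by linarith)
  obtain ⟨D, hD⟩ : ∃ D : ℝ, D = (Nat.log 2 n : ℝ) + 2 := ⟨_, rfl⟩
  have hD0 : 0 < D := by rw [hD]; positivity
  have hDlog : D * Real.log 2 ≤ 3 * Real.log (n + 1) := by
    have h1 : (2 : ℝ) ^ Nat.log 2 n ≤ n := by
      exact_mod_cast Nat.pow_log_le_self 2 (by omega : n ≠ 0)
    have h2 := Real.log_le_log (by positivity) (h1.trans (by linarith : (n : ℝ) ≤ n + 1))
    rw [Real.log_pow] at h2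
    rw [hD, add_mul]
    linarith
  obtain ⟨x, hx⟩ : ∃ x : ℝ, x = (n : ℝ) ^ (1 / 3 : ℝ) := ⟨_, rfl⟩
  have hx0 : 0 < x := hx ▸ Real.rpow_pos_of_pos hn0 _
  have hx3 : x ^ 3 = n := by
    rw [hx, ← Real.rpow_natCast, ← Real.rpow_mul hn0.le]; norm_num
  rw [Real.rpow_neg hn0.le, ← hx, pow_one]
  have hW := P.rsdWelfare_nonneg
  have hopt : P.opt ≤ 8 * D * x * P.rsdWelfare := by
    have : Nonempty {μ : A → Option I // P.IsMatching μ} :=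
      ⟨⟨fun _ => none, by simp [IsMatching]⟩⟩
    refine ciSup_le fun μ => ?_
    have h := P.welfare_pow_three_le μ.2
    rw [← hnn, ← hD, ← hx3] at h
    refine le_of_pow_le_pow_left₀ (by norm_num : 3 ≠ 0) (by positivity) (h.trans (le_of_eq ?_))
    ring
  have hl0 : 0 < Real.log ((n : ℝ) + 1) := hl2.trans_le hln
  calc Real.log 2 / 24 * x⁻¹ / Real.log (n + 1) * P.opt
      ≤ Real.log 2 / 24 * x⁻¹ / Real.log (n + 1) * (8 * D * x * P.rsdWelfare) := by gcongr
    _ = D * Real.log 2 * (P.rsdWelfare / (3 * Real.log (n + 1))) := by field_simp; ring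
    _ ≤ 3 * Real.log (n + 1) * (P.rsdWelfare / (3 * Real.log (n + 1))) := by gcongr
    _ = P.rsdWelfare := by field_simp

end LowerBound

end Market

namespace Market

/-! ### Who arrives first within a group -/

section FirstArrival

variable {A : Type*} [Fintype A] [DecidableEq A]

open Classical in
/-- Each member of a group of agents is equally likely to be the first of them to arrive. -/
theorem avg_first_mul_card_le (U : Finset A) {a : A} (ha : a ∈ U) :
    avg (fun σ => if ∀ y ∈ U, σ.symm a ≤ σ.symm y then (1 : ℝ) else 0) * U.card ≤ 1 := by
  let p : A → ℝ := fun x => avg (fun σ : Fin (Fintype.card A) ≃ A =>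
    if ∀ y ∈ U, σ.symm x ≤ σ.symm y then (1 : ℝ) else 0)
  have hp : ∀ x ∈ U, p x = p a := by
    intro x hx
    -- Here agents are exchanged rather than times; the swap preserves `U`.
    rw [show p x = _ from (avg_comp_equiv (Equiv.equivCongr (Equiv.refl _) (Equiv.swap a x)) _).symm]
    refine congrArg avg (funext fun σ => if_congr ?_ rfl rfl)
    have h1 : Equiv.equivCongr (Equiv.refl _) (Equiv.swap a x) σ = σ.trans (Equiv.swap a x) := by
      ext; simp [Equiv.equivCongr]
    have hU : ∀ y ∈ U, Equiv.swap a x y ∈ U := by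
      intro y hy
      rw [Equiv.swap_apply_def]
      split_ifs <;> assumption
    rw [h1]
    simp only [Equiv.symm_trans_apply, Equiv.symm_swap, Equiv.swap_apply_right]
    refine ⟨fun h y hy => ?_, fun h y hy => h _ (hU y hy)⟩
    have := h _ (hU y hy)
    rwa [Equiv.swap_apply_self] at this
  calc p a * U.card = ∑ x ∈ U, p x := by
        rw [Finset.sum_congr rfl hp, Finset.sum_const, nsmul_eq_mul, mul_comm]
    _ ≤ avg (fun _ : Fin (Fintype.card A) ≃ A => 1) := by
        rw [← avg_sum]
        refine avg_mono fun σ => ?_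
        rw [← Finset.sum_filter, ← Finset.cast_card]
        refine (Nat.cast_le.2 (Finset.card_le_one.2 fun x hx y hy => ?_)).trans_eq Nat.cast_one
        rw [Finset.mem_filter] at hx hy
        exact σ.symm.injective (le_antisymm (hx.2 y hy.1) (hy.2 x hx.1))
    _ = 1 := avg_const 1

end FirstArrival

/-! ### The good/bad market and the upper bound -/

section GoodBad

theorem utility_of_pref_eq_append {A I : Type*} [DecidableEq I] (P : Market A I) {a : A}
    {l : List I} {i : I} (h : P.pref a = l ++ [i]) : P.utility a i = 1 / ((l.length : ℝ) + 1) := by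
  have hi : i ∉ l := fun hil => by
    have := P.nodup a
    rw [h, List.nodup_append] at this
    exact this.2.2 i hil i (by simp) rfl
  rw [utility, if_pos (by simp [h]), h, List.idxOf_append_of_notMem hi]
  simp

variable {n s : ℕ} (hs : 0 < s)

theorem welfare_le_opt {A I : Type*} [Fintype A] [Fintype I] [DecidableEq I] (P : Market A I)
    {μ : A → Option I} (hμ : P.IsMatching μ) : P.welfare μ ≤ P.opt := by
  classical
  exact le_ciSup (f := fun μ : {μ : A → Option I // P.IsMatching μ} => P.welfare μ.1)
    (Set.finite_range _).bddAbove ⟨μ, hμ⟩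

theorem sq_le_opt_goodBad : (s : ℝ) ^ 2 ≤ (goodBad n s hs).opt := by
  let μ : Fin (s ^ 2) ⊕ Fin (n - s ^ 2) → Option (Fin (s ^ 2) ⊕ Fin s) :=
    Sum.elim (fun g => some (Sum.inl g)) fun _ => none
  have hμ : (goodBad n s hs).IsMatching μ := by
    refine ⟨?_, ?_⟩
    · rintro (g | b) i h
      · simp only [μ, Sum.elim_inl, Option.some_inj] at h
        simp [goodBad, ← h]
      · simp [μ] at h
    · rintro (g | b) (g' | b') i h h' <;> simp_all [μ]
      rw [← h'] at h
      exact Sum.inl_injective h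
  refine le_trans (le_of_eq ?_) (welfare_le_opt _ hμ)
  simp [welfare, μ, utility, goodBad]

/-- The item that the bad agent `b` lists last. -/
def lastItem (hs : 0 < s) (b : Fin (n - s ^ 2)) : Fin (s ^ 2) :=
  ⟨((b : ℕ) + 1) % s ^ 2, Nat.mod_lt _ (pow_pos hs 2)⟩

theorem goodBad_pref_inr (b : Fin (n - s ^ 2)) : (goodBad n s hs).pref (Sum.inr b) =
    (List.finRange s).map Sum.inr ++ [Sum.inl (lastItem hs b)] := rfl

theorem eq_lastItem {b : Fin (n - s ^ 2)} {i : Fin (s ^ 2)}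
    (h : Sum.inl i ∈ (goodBad n s hs).pref (Sum.inr b)) : i = lastItem hs b := by
  simpa [goodBad_pref_inr] using h

theorem utility_goodBad_inl_le (b : Fin (n - s ^ 2)) (i : Fin (s ^ 2)) :
    (goodBad n s hs).utility (Sum.inr b) (Sum.inl i) ≤ 1 / s := by
  by_cases h : Sum.inl i ∈ (goodBad n s hs).pref (Sum.inr b)
  · have hs0 : (0 : ℝ) < s := by exact_mod_cast hs
    rw [utility_of_pref_eq_append (goodBad n s hs) (l := (List.finRange s).map Sum.inr)
      (by rw [goodBad_pref_inr, ← eq_lastItem hs h]), List.length_map, List.length_finRange]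
    gcongr
    linarith
  · rw [utility, if_neg h]; positivity

theorem card_filter_eq_some_inr_le (σ : Fin (Fintype.card (Fin (s ^ 2) ⊕ Fin (n - s ^ 2))) ≃ _) :
    (Finset.univ.filter fun b : Fin (n - s ^ 2) =>
      ∃ j, (goodBad n s hs).serialDictatorship σ (Sum.inr b) = some (Sum.inr j)).card ≤ s := by
  conv_rhs => rw [← Fintype.card_fin s, ← Finset.card_univ]
  have : ∀ b ∈ (Finset.univ.filter fun b : Fin (n - s ^ 2) =>
      ∃ j, (goodBad n s hs).serialDictatorship σ (Sum.inr b) = some (Sum.inr j)),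
      ∃ j, (goodBad n s hs).serialDictatorship σ (Sum.inr b) = some (Sum.inr j) := by simp
  have : Nonempty (Fin s) := ⟨⟨0, hs⟩⟩
  choose! f hf using ‹∀ b ∈ _, _›
  refine Finset.card_le_card_of_injOn f (fun _ _ => Finset.mem_coe.2 (Finset.mem_univ _))
    fun b hb b' hb' h => ?_
  have h1 := hf b hb
  rw [h] at h1
  exact Sum.inr_injective (serialDictatorship_injective h1 (hf b' hb'))

theorem card_filter_eq_some_inl_le (σ : Fin (Fintype.card (Fin (s ^ 2) ⊕ Fin (n - s ^ 2))) ≃ _) :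
    (Finset.univ.filter fun b : Fin (n - s ^ 2) =>
      ∃ i, (goodBad n s hs).serialDictatorship σ (Sum.inr b) = some (Sum.inl i)).card ≤ s ^ 2 := by
  conv_rhs => rw [← Fintype.card_fin (s ^ 2), ← Finset.card_univ]
  refine Finset.card_le_card_of_injOn (lastItem hs)
    (fun _ _ => Finset.mem_coe.2 (Finset.mem_univ _)) fun b hb b' hb' h => ?_
  obtain ⟨i, hi⟩ := (Finset.mem_filter.1 hb).2
  obtain ⟨i', hi'⟩ := (Finset.mem_filter.1 hb').2
  rw [eq_lastItem hs (mem_pref_of_eq_some hi), h,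
    ← eq_lastItem hs (mem_pref_of_eq_some hi')] at hi
  exact Sum.inr_injective (serialDictatorship_injective hi hi')

/-- The good agent `g` and the bad agents competing with him. -/
def competitors (hs : 0 < s) (g : Fin (s ^ 2)) : Finset (Fin (s ^ 2) ⊕ Fin (n - s ^ 2)) :=
  insert (Sum.inl g) ((Finset.univ.filter fun b => lastItem hs b = g).map ⟨_, Sum.inr_injective⟩)

/-- The `n - s ^ 2 ≥ (s - 1) * s ^ 2` bad agents run through at least `s - 1` full cycles of last
items; `g` himself is the remaining competitor. -/
theorem le_card_competitors (hn : s ^ 3 ≤ n) (g : Fin (s ^ 2)) :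
    s ≤ (competitors (n := n) hs g).card := by
  rw [competitors, Finset.card_insert_of_notMem (by simp), Finset.card_map]
  have hr : (g + (s ^ 2 - 1)) % s ^ 2 < s ^ 2 := Nat.mod_lt _ (pow_pos hs 2)
  -- This is `g - 1` modulo `s ^ 2`, undoing the shift by one in the cyclic assignment.
  obtain ⟨r, hr'⟩ : ∃ r, r = (g + (s ^ 2 - 1)) % s ^ 2 := ⟨_, rfl⟩
  rw [← hr'] at hr
  have hlt : ∀ j : Fin (s - 1), j * s ^ 2 + r < n - s ^ 2 := by
    intro j
    have h1 : ((j : ℕ) + 1 + 1) * s ^ 2 ≤ s * s ^ 2 :=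
      Nat.mul_le_mul_right _ (by have := j.2; omega)
    have h2 : s * s ^ 2 ≤ n := by rw [← pow_succ']; exact hn
    rw [add_mul, add_mul] at h1
    omega
  have hcard : s - 1 ≤ (Finset.univ.filter fun b : Fin (n - s ^ 2) => lastItem hs b = g).card := by
    conv_lhs => rw [← Fintype.card_fin (s - 1), ← Finset.card_univ]
    refine Finset.card_le_card_of_injOn (fun j => ⟨j * s ^ 2 + r, hlt j⟩) (fun j _ => ?_)
      fun j _ j' _ h => ?_
    · simp only [Finset.coe_filter, Finset.mem_univ, true_and, Set.mem_ofPred_eq]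
      ext
      simp only [lastItem]
      have h1 : (r + 1) % s ^ 2 = g := by
        rw [hr', Nat.mod_add_mod, add_assoc, Nat.sub_add_cancel (pow_pos hs 2), Nat.add_mod_right,
          Nat.mod_eq_of_lt g.2]
      rw [add_assoc, mul_comm, Nat.mul_add_mod, h1]
    · have h1 : (j : ℕ) * s ^ 2 + r = j' * s ^ 2 + r := by simpa using h
      exact Fin.ext (Nat.eq_of_mul_eq_mul_right (pow_pos hs 2) (Nat.add_right_cancel h1))
  omega

/-- A good agent gets his item only if a competitor gets another item, or if he arrives first. -/
theorem good_matched (σ : Fin (Fintype.card (Fin (s ^ 2) ⊕ Fin (n - s ^ 2))) ≃ _) (g : Fin (s ^ 2))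
    (h : (goodBad n s hs).serialDictatorship σ (Sum.inl g) ≠ none) :
    (∃ b, lastItem hs b = g ∧
      ∃ j, (goodBad n s hs).serialDictatorship σ (Sum.inr b) = some (Sum.inr j)) ∨
    ∀ y ∈ competitors hs g, σ.symm (Sum.inl g) ≤ σ.symm y := by
  classical
  obtain ⟨i, hi⟩ := Option.ne_none_iff_exists'.1 h
  have hig : i = Sum.inl g := by simpa [goodBad] using mem_pref_of_eq_some hi
  subst hig
  rw [or_iff_not_imp_left]
  intro hno y hy
  by_contra! hlt
  rw [competitors, Finset.mem_insert] at hy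
  rcases hy with rfl | hy
  · exact lt_irrefl _ hlt
  simp only [Finset.mem_map, Finset.mem_filter, Finset.mem_univ, true_and,
    Function.Embedding.coeFn_mk] at hy
  obtain ⟨b, hb, rfl⟩ := hy
  -- The item of `g` was free when the earlier competitor `b` came, so `b` cannot have stayed
  -- unmatched; taking that item would contradict `hi`.
  have hfree := (freeAt_of_eq_some hi).mono (Fin.lt_def.1 hlt).le
  cases hx : (goodBad n s hs).serialDictatorship σ (Sum.inr b) with
  | none =>
    rw [serialDictatorship_eq_find, List.find?_eq_none] at hx
    have := hx (Sum.inl g) (by simp [goodBad_pref_inr, hb])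
    simp [hfree] at this
  | some x =>
    rcases x with i | j
    · have := eq_lastItem hs (mem_pref_of_eq_some hx)
      rw [this, hb] at hx
      exact freeAt_of_eq_some hi _ (Fin.lt_def.1 hlt) hx
    · exact hno ⟨b, hb, j, hx⟩

open Classical in
-- Three contributions of at most `s` each: bad agents with a primed item; at most `s ^ 2` bad
-- agents with their last item, worth at most `1 / s`; and good agents one of whose competitors took
-- a primed item. Any other matched good agent precedes all his competitors.
theorem sum_payoff_goodBad_le (σ : Fin (Fintype.card (Fin (s ^ 2) ⊕ Fin (n - s ^ 2))) ≃ _) :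
    ∑ a, (goodBad n s hs).payoff σ a ≤ 3 * s +
      ∑ g, if ∀ y ∈ competitors (n := n) hs g, σ.symm (Sum.inl g) ≤ σ.symm y
        then (1 : ℝ) else 0 := by
  have hs0 : (0 : ℝ) < s := by exact_mod_cast hs
  set B := Finset.univ.filter fun b : Fin (n - s ^ 2) =>
    ∃ j, (goodBad n s hs).serialDictatorship σ (Sum.inr b) = some (Sum.inr j) with hB
  set B' := Finset.univ.filter fun b : Fin (n - s ^ 2) =>
    ∃ i, (goodBad n s hs).serialDictatorship σ (Sum.inr b) = some (Sum.inl i) with hB'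
  have cB : (B.card : ℝ) ≤ s := by exact_mod_cast card_filter_eq_some_inr_le hs σ
  have cB' : (B'.card : ℝ) ≤ s ^ 2 := by exact_mod_cast card_filter_eq_some_inl_le hs σ
  have cG : ((B.image (lastItem hs)).card : ℝ) ≤ s :=
    le_trans (by exact_mod_cast Finset.card_image_le) cB
  have hbad : ∀ b, (goodBad n s hs).payoff σ (Sum.inr b) ≤
      (if b ∈ B then (1 : ℝ) else 0) + (if b ∈ B' then (1 : ℝ) else 0) * (1 / s) := by
    intro b
    simp only [hB, hB', Finset.mem_filter, Finset.mem_univ, true_and]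
    cases hx : (goodBad n s hs).serialDictatorship σ (Sum.inr b) with
    | none => simp [payoff, hx]
    | some x =>
      rcases x with i | j
      · simpa [payoff, hx] using utility_goodBad_inl_le hs b i
      · simpa [payoff, hx] using utility_le_one (goodBad n s hs) (Sum.inr b) (Sum.inr j)
  have hgood : ∀ g, (goodBad n s hs).payoff σ (Sum.inl g) ≤
      (if g ∈ B.image (lastItem hs) then (1 : ℝ) else 0) +
      if ∀ y ∈ competitors (n := n) hs g, σ.symm (Sum.inl g) ≤ σ.symm y then (1 : ℝ) else 0 := by
    intro g
    by_cases hx : (goodBad n s hs).serialDictatorship σ (Sum.inl g) = none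
    · rw [payoff, hx]
      simp only [Option.elim_none]
      positivity
    · have h1 : (goodBad n s hs).payoff σ (Sum.inl g) ≤ 1 := by
        obtain ⟨i, hi⟩ := Option.ne_none_iff_exists'.1 hx
        rw [payoff, hi]
        exact utility_le_one _ _ _
      refine h1.trans ?_
      rcases good_matched hs σ g hx with ⟨b, hb, hj⟩ | h
      · rw [if_pos (Finset.mem_image.2 ⟨b, by simpa [hB] using hj, hb⟩)]
        split_ifs <;> norm_num
      · rw [if_pos h]
        split_ifs <;> norm_num
  rw [Fintype.sum_sum_type]
  have e1 := Finset.sum_le_sum fun g (_ : g ∈ Finset.univ) => hgood g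
  have e2 := Finset.sum_le_sum fun b (_ : b ∈ Finset.univ) => hbad b
  rw [Finset.sum_add_distrib, Finset.sum_ite_mem, Finset.univ_inter, Finset.sum_const,
    nsmul_eq_mul, mul_one] at e1
  rw [Finset.sum_add_distrib, ← Finset.sum_mul, Finset.sum_ite_mem, Finset.univ_inter,
    Finset.sum_const, nsmul_eq_mul, mul_one, Finset.sum_ite_mem, Finset.univ_inter,
    Finset.sum_const, nsmul_eq_mul, mul_one] at e2
  have e3 : (B'.card : ℝ) * (1 / s) ≤ s := by
    rw [mul_one_div, div_le_iff₀ hs0, ← sq]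
    exact cB'
  linarith

theorem rsdWelfare_goodBad_le (hn : s ^ 3 ≤ n) : (goodBad n s hs).rsdWelfare ≤ 4 * s := by
  classical
  have hs0 : (0 : ℝ) < s := by exact_mod_cast hs
  rw [rsdWelfare_eq_avg]
  refine (avg_mono (sum_payoff_goodBad_le hs)).trans ?_
  rw [avg_add, avg_const, avg_sum]
  have h : ∀ g ∈ (Finset.univ : Finset (Fin (s ^ 2))),
      avg (fun σ => if ∀ y ∈ competitors (n := n) hs g, σ.symm (Sum.inl g) ≤ σ.symm y
        then (1 : ℝ) else 0) ≤ 1 / s := by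
    intro g _
    have h1 := avg_first_mul_card_le (competitors (n := n) hs g) (Finset.mem_insert_self _ _)
    have h2 : (s : ℝ) ≤ (competitors (n := n) hs g).card := by
      exact_mod_cast le_card_competitors hs hn g
    rw [le_div_iff₀ hs0]
    refine le_trans ?_ h1
    exact mul_le_mul_of_nonneg_left h2 (avg_nonneg fun σ => by split_ifs <;> norm_num)
  have := Finset.sum_le_sum h
  rw [Finset.sum_const, Finset.card_univ, Fintype.card_fin, nsmul_eq_mul] at this
  have e : ((s ^ 2 : ℕ) : ℝ) * (1 / s) = s := by push_cast; field_simp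
  linarith

theorem rsdWelfare_goodBad_le_mul_opt (hn : s ^ 3 ≤ n) (hn' : n < (s + 1) ^ 3) :
    (goodBad n s hs).rsdWelfare ≤ 8 * (n : ℝ) ^ (-(1 / 3 : ℝ)) * (goodBad n s hs).opt := by
  have hs0 : (0 : ℝ) < s := by exact_mod_cast hs
  have hn0 : (0 : ℝ) < n := by exact_mod_cast (pow_pos hs 3).trans_le hn
  -- Since `s ≥ 1`, rounding the cube root down loses at most a factor `2`.
  have hs2 : n ≤ (2 * s) ^ 3 := hn'.le.trans (Nat.pow_le_pow_left (by omega) 3)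
  have hx : (n : ℝ) ^ (1 / 3 : ℝ) ≤ 2 * s := by
    calc (n : ℝ) ^ (1 / 3 : ℝ) ≤ ((2 * s : ℝ) ^ 3) ^ (1 / 3 : ℝ) := by
          gcongr; exact_mod_cast hs2
      _ = 2 * s := by
          rw [← Real.rpow_natCast, ← Real.rpow_mul (by positivity)]; norm_num
  have hx0 : 0 < (n : ℝ) ^ (1 / 3 : ℝ) := Real.rpow_pos_of_pos hn0 _
  rw [Real.rpow_neg hn0.le]
  calc (goodBad n s hs).rsdWelfare ≤ 4 * s := rsdWelfare_goodBad_le hs hn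
    _ = 8 * (2 * s : ℝ)⁻¹ * s ^ 2 := by field_simp; norm_num
    _ ≤ _ := by
      gcongr
      exact sq_le_opt_goodBad hs

end GoodBad

end Market

theorem theorem5 :
    -- RSD always obtains at least a `c * n ^ (-1/3) / polylog n` fraction of the social optimum
    (∃ c : ℝ, 0 < c ∧ ∃ k : ℕ,
      ∀ (A I : Type*) [Fintype A] [DecidableEq A] [Fintype I] [DecidableEq I] (P : Market A I)
        (n : ℕ), n = Fintype.card A → 1 ≤ n →
        c * (n : ℝ) ^ (-(1 / 3 : ℝ)) / Real.log ((n : ℝ) + 1) ^ k * P.opt ≤ P.rsdWelfare) ∧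
    -- for every `n` there is a good/bad market with `n` agents where RSD does no better, up to
    -- polylogarithmic factors; here `s` is the integer part of `n ^ (1/3)`
    (∃ C : ℝ, 0 < C ∧ ∃ k : ℕ,
      ∀ (n s : ℕ) (hs : 0 < s), s ^ 3 ≤ n → n < (s + 1) ^ 3 →
        0 < (Market.goodBad n s hs).opt ∧
        (Market.goodBad n s hs).rsdWelfare ≤
          C * (n : ℝ) ^ (-(1 / 3 : ℝ)) * Real.log ((n : ℝ) + 1) ^ k *
            (Market.goodBad n s hs).opt) := by
  -- One logarithm suffices below, from the number of length classes; above, the exponent `0` shows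
  -- that no logarithm is needed.
  refine ⟨⟨Real.log 2 / 24, by have := Real.log_pos one_lt_two; positivity, 1, ?_⟩,
    8, by norm_num, 0, ?_⟩
  · rintro A I _ _ _ _ P n rfl hn
    exact P.le_rsdWelfare hn
  · intro n s hs hn hn'
    have hs0 : (0 : ℝ) < s := by exact_mod_cast hs
    refine ⟨lt_of_lt_of_le (by positivity) (Market.sq_le_opt_goodBad hs), ?_⟩
    rw [pow_zero, mul_one]
    exact Market.rsdWelfare_goodBad_le_mul_opt hs hn hn'
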